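/- For $x>0$ and $\nu\in\mathbb{C}$ let $K_\nu(x)$ be the modified Bessel function of the second kind, $$K_\nu(x)=\frac{x^{\nu}}{2^{\nu+1}}\int_0^\infty \exp\left(-t-\frac{x^2}{4t}\right)\frac{dt}{t^{\nu+1}}.$$ Let $a>0$ be real and let $\nu,\rho\in\mathbb{C}$ satisfy $\operatorname{Re}\rho>2|\operatorname{Re}\nu|$, $\nu\notin\mathbb{Z}$ and $\rho\notin\{1,2,3,\dots\}$. Then $x\mapsto x^{\rho-1}K_\nu(ax)^2$ is integrable on $(0,\infty)$ and $$\int_0^\infty x^{\rho-1}K_\nu(ax)^2\,dx=\frac{2^{\rho-3}}{a^{\rho}}\cdot\frac{\Gamma\left(\frac{\rho}{2}\right)\Gamma(1-\rho)}{\Gamma\left(1-\frac{\rho}{2}\right)}\left[\frac{\Gamma(\nu)\Gamma(1-\nu)\Gamma\left(\frac{\rho}{2}-\nu\right)}{\Gamma\left(1-\frac{\rho}{2}-\nu\right)}+\frac{\Gamma(-\nu)\Gamma(1+\nu)\Gamma\left(\frac{\rho}{2}+\nu\right)}{\Gamma\left(1-\frac{\rho}{2}+\nu\right)}\right],$$ where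 $1/\Gamma$ is taken to be $0$ at the poles of $\Gamma$. -/

import Mathlib

/-- The modified Bessel function of the second kind (Macdonald function) `K_ν(x)`, for
`x > 0` and arbitrary complex order `ν`, through the integral representation
`K_ν(x) = x ^ ν / 2 ^ (ν + 1) * ∫_0^∞ exp (-t - x ^ 2 / (4 t)) dt / t ^ (ν + 1)`.
For `x > 0` the integral converges absolutely for every complex `ν`. -/
noncomputable def besselK (ν : ℂ) (x : ℝ) : ℂ :=
  (x : ℂ) ^ ν / (2 : ℂ) ^ (ν + 1) *
    ∫ t in Set.Ioi (0 : ℝ), (Real.exp (-t - x ^ 2 / (4 * t)) : ℂ) / (t : ℂ) ^ (ν + 1)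

section

open MeasureTheory Set Complex

/-! Put `ρ = 2s`. Squaring the integral for `K_ν(2x)` and substituting `w = x ^ 2` gives a triple
integral in `t₁`, `t₂`, `w`. Integrating out `w` leaves `Γ(s+ν) (1/t₁ + 1/t₂)^(-(s+ν))`. Since `1/t₁
+ 1/t₂ = (t₁ + t₂)/(t₁ t₂)`, this is a power of `t₁ + t₂` times powers of `t₁` and `t₂`. Writing the
power of `t₁ + t₂` as a Gamma integral in a new variable `y` makes `t₁` and `t₂` separate; they
contribute `Γ(s)^2 (1+y)^(-2s)`, and Euler's beta integral in `y` finishes: `Γ(s)^2 Γ(s+ν) Γ(s-ν) /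
(8 Γ(2s))`. The reflection formula turns this symmetric form into the stated bracket. -/

/-- Lebesgue measure on the positive half-line. -/
noncomputable abbrev volIoi : Measure ℝ := volume.restrict (Ioi 0)

theorem ae_volIoi_pos : ∀ᵐ x ∂volIoi, 0 < x := ae_restrict_mem measurableSet_Ioi

theorem ae_volIoi_prod_pos : ∀ᵐ x ∂volIoi.prod volIoi, 0 < x.1 ∧ 0 < x.2 := by
  rw [Measure.prod_restrict]
  exact ae_restrict_mem (measurableSet_Ioi.prod measurableSet_Ioi)

theorem ofReal_mul_cpow {a b : ℝ} (ha : 0 < a) (hb : 0 < b) (r : ℂ) :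
    ((a : ℂ) * b) ^ r = (a : ℂ) ^ r * (b : ℂ) ^ r :=
  mul_cpow_ofReal_nonneg ha.le hb.le r

theorem one_div_ofReal_cpow {a : ℝ} (ha : 0 < a) (r : ℂ) :
    (1 / (a : ℂ)) ^ r = (a : ℂ) ^ (-r) := by
  rw [one_div, inv_cpow, cpow_neg]
  rw [arg_ofReal_of_nonneg ha.le]
  exact Real.pi_pos.ne

theorem norm_cpow_mul_exp_neg {t r : ℝ} (ht : 0 < t) (p : ℂ) :
    ‖(t : ℂ) ^ (p - 1) * cexp (-(r * t))‖ = t ^ (p.re - 1) * Real.exp (-(r * t)) := by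
  rw [norm_mul, norm_cpow_eq_rpow_re_of_pos ht, norm_exp]
  simp

theorem integrable_cpow_mul_exp_neg {p : ℂ} (hp : 0 < p.re) {r : ℝ} (hr : 0 < r) :
    Integrable (fun t : ℝ => (t : ℂ) ^ (p - 1) * cexp (-(r * t))) volIoi := by
  have h := integrableOn_rpow_mul_exp_neg_mul_rpow (s := p.re - 1) (p := 1) (b := r)
    (by linarith) one_pos hr
  refine Integrable.mono' h (by fun_prop) ?_
  filter_upwards [ae_volIoi_pos] with t ht
  rw [norm_cpow_mul_exp_neg ht]
  simp

/-! ### Adding and removing a Gamma integral by Fubini -/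

section GammaKernel

variable {α : Type*} [MeasurableSpace α] {μ : Measure α} {g : α → ℂ} {c : α → ℝ} {p : ℂ}

/-- The inner integral of the norm is exactly `‖g z * c z ^ (-p)‖ * Γ(Re p)`, so Tonelli loses
nothing. Being an equivalence, it justifies every change of order below without separate estimates.
-/
theorem integrable_prod_gamma_iff (hg : Measurable g) (hc : Measurable c)
    (hpos : ∀ᵐ z ∂μ, 0 < c z) (hp : 0 < p.re) :
    Integrable (fun w : α × ℝ => g w.1 * ((w.2 : ℂ) ^ (p - 1) * cexp (-(c w.1 * w.2))))
      (μ.prod volIoi) ↔ Integrable (fun z => g z * (c z : ℂ) ^ (-p)) μ := by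
  have hm : AEStronglyMeasurable
      (fun w : α × ℝ => g w.1 * ((w.2 : ℂ) ^ (p - 1) * cexp (-(c w.1 * w.2))))
      (μ.prod volIoi) := by
    apply Measurable.aestronglyMeasurable
    fun_prop
  have hm' : AEStronglyMeasurable (fun z => g z * (c z : ℂ) ^ (-p)) μ := by
    apply Measurable.aestronglyMeasurable
    fun_prop
  rw [integrable_prod_iff hm, ← integrable_norm_iff hm']
  have h1 : ∀ᵐ z ∂μ, Integrable
      (fun t : ℝ => g z * ((t : ℂ) ^ (p - 1) * cexp (-(c z * t)))) volIoi := by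
    filter_upwards [hpos] with z hz
    exact (integrable_cpow_mul_exp_neg hp hz).const_mul _
  rw [and_iff_right h1]
  have h2 : (fun z => ∫ t, ‖g z * ((t : ℂ) ^ (p - 1) * cexp (-(c z * t)))‖ ∂volIoi) =ᵐ[μ]
      fun z => ‖g z * (c z : ℂ) ^ (-p)‖ * Real.Gamma p.re := by
    filter_upwards [hpos] with z hz
    simp_rw [norm_mul (g z)]
    rw [integral_const_mul, setIntegral_congr_fun measurableSet_Ioi
      (fun t (ht : 0 < t) => norm_cpow_mul_exp_neg ht p),
      Real.integral_rpow_mul_exp_neg_mul_Ioi hp hz, norm_cpow_eq_rpow_re_of_pos hz, neg_re,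
      Real.rpow_neg hz.le, one_div, Real.inv_rpow hz.le, mul_assoc]
  rw [integrable_congr h2]
  exact integrable_mul_const_iff (Real.Gamma_pos_of_pos hp).ne'.isUnit _

theorem integral_prod_gamma [SFinite μ] (hg : Measurable g) (hc : Measurable c)
    (hpos : ∀ᵐ z ∂μ, 0 < c z) (hp : 0 < p.re)
    (hi : Integrable (fun z => g z * (c z : ℂ) ^ (-p)) μ) :
    ∫ w : α × ℝ, g w.1 * ((w.2 : ℂ) ^ (p - 1) * cexp (-(c w.1 * w.2))) ∂μ.prod volIoi =
      Gamma p * ∫ z, g z * (c z : ℂ) ^ (-p) ∂μ := by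
  rw [integral_prod _ ((integrable_prod_gamma_iff hg hc hpos hp).2 hi), ← integral_const_mul]
  refine integral_congr_ae ?_
  filter_upwards [hpos] with z hz
  rw [integral_const_mul, integral_cpow_mul_exp_neg_mul_Ioi hp hz, one_div_ofReal_cpow hz]
  ring

end GammaKernel

/-! ### Beta integral and the triple integral -/

/-- Euler's beta integral on the half-line. -/
theorem beta_Ioi {p q : ℂ} (hp : 0 < p.re) (hq : 0 < q.re) :
    Integrable (fun y : ℝ => (y : ℂ) ^ (p - 1) * ((1 + y : ℝ) : ℂ) ^ (-(p + q))) volIoi ∧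
      Gamma (p + q) * ∫ y, (y : ℂ) ^ (p - 1) * ((1 + y : ℝ) : ℂ) ^ (-(p + q)) ∂volIoi =
        Gamma p * Gamma q := by
  have hpq : 0 < (p + q).re := by rw [add_re]; linarith
  have hE : (fun r : ℝ => ((r : ℂ) ^ (p + q - 1) * cexp (-r)) * (r : ℂ) ^ (-p)) =ᵐ[volIoi]
      fun r : ℝ => (r : ℂ) ^ (q - 1) * cexp (-((1 : ℝ) * r)) := by
    filter_upwards [ae_volIoi_pos] with r hr
    have hr' : (r : ℂ) ≠ 0 := ofReal_ne_zero.2 hr.ne'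
    rw [mul_right_comm, ← cpow_add _ _ hr']
    congr 2
    · ring
    · simp
  have hI : Integrable (fun r : ℝ => ((r : ℂ) ^ (p + q - 1) * cexp (-r)) * (r : ℂ) ^ (-p)) volIoi :=
    (integrable_congr hE).2 (integrable_cpow_mul_exp_neg hq one_pos)
  have hV : ∫ r : ℝ, ((r : ℂ) ^ (p + q - 1) * cexp (-r)) * (r : ℂ) ^ (-p) ∂volIoi = Gamma q := by
    rw [integral_congr_ae hE, integral_cpow_mul_exp_neg_mul_Ioi hq one_pos]
    simp
  have hg : Measurable (fun r : ℝ => (r : ℂ) ^ (p + q - 1) * cexp (-r)) := by fun_prop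
  have hg' : Measurable (fun y : ℝ => (y : ℂ) ^ (p - 1)) := by fun_prop
  have hc' : Measurable (fun y : ℝ => 1 + y) := by fun_prop
  have hc0 : ∀ᵐ y ∂volIoi, 0 < 1 + y := by
    filter_upwards [ae_volIoi_pos] with y hy
    linarith
  -- Both orders of integrating `y^(p-1) r^(p+q-1) exp(-(1+y)r)` are Gamma integrals: `r` first
  -- gives the beta integrand, `y` first gives `Γ(q)`.
  have hswap : (fun w : ℝ × ℝ => (w.1 : ℂ) ^ (p - 1) *
        ((w.2 : ℂ) ^ (p + q - 1) * cexp (-((1 + w.1 : ℝ) * w.2)))) =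
      (fun w : ℝ × ℝ => ((w.1 : ℂ) ^ (p + q - 1) * cexp (-w.1)) *
        ((w.2 : ℂ) ^ (p - 1) * cexp (-(w.1 * w.2)))) ∘ Prod.swap := by
    funext w
    have : cexp (-((1 + w.1 : ℝ) * w.2)) = cexp (-w.2) * cexp (-(w.2 * w.1)) := by
      rw [← Complex.exp_add]; congr 1; push_cast; ring
    simp only [Function.comp, Prod.fst_swap, Prod.snd_swap, this]
    ring
  have h1 := (integrable_prod_gamma_iff hg measurable_id ae_volIoi_pos hp).2 hI
  have h2 := integral_prod_gamma hg measurable_id ae_volIoi_pos hp hI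
  have h3 := (integrable_prod_gamma_iff hg' hc' hc0 hpq).1 (by rw [hswap]; exact h1.swap)
  refine ⟨h3, ?_⟩
  rw [← integral_prod_gamma hg' hc' hc0 hpq h3, hswap]
  refine (integral_prod_swap _).trans (h2.trans ?_)
  rw [← hV]
  rfl

/-- For fixed `y = x.2` the other two variables separate, each giving `Γ(s) (1+y)^(-s)`; as `p + q =
2s`, a beta integral remains. The proof builds this up from the beta integral. -/
theorem integrable_beta_kernel {s p q : ℂ} (hs : 0 < s.re) (hp : 0 < p.re) (hq : 0 < q.re)
    (hpq : p + q = 2 * s) :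
    Integrable (fun x : (ℝ × ℝ) × ℝ =>
        ((x.1.1 : ℂ) ^ (s - 1) * (x.1.2 : ℂ) ^ (s - 1) * cexp (-(x.1.1 + x.1.2))) *
          ((x.2 : ℂ) ^ (p - 1) * cexp (-((x.1.1 + x.1.2 : ℝ) * x.2))))
        ((volIoi.prod volIoi).prod volIoi) ∧
      Gamma (2 * s) * ∫ x : (ℝ × ℝ) × ℝ,
        ((x.1.1 : ℂ) ^ (s - 1) * (x.1.2 : ℂ) ^ (s - 1) * cexp (-(x.1.1 + x.1.2))) *
          ((x.2 : ℂ) ^ (p - 1) * cexp (-((x.1.1 + x.1.2 : ℝ) * x.2)))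
        ∂(volIoi.prod volIoi).prod volIoi = Gamma s ^ 2 * (Gamma p * Gamma q) := by
  obtain ⟨hA, hAv⟩ := beta_Ioi hp hq
  have hc : Measurable (fun y : ℝ => 1 + y) := by fun_prop
  have hc2 : Measurable (fun z : ℝ × ℝ => 1 + z.1) := by fun_prop
  have hpos : ∀ᵐ y ∂volIoi, 0 < 1 + y := by
    filter_upwards [ae_volIoi_pos] with y hy
    linarith
  have hpos2 : ∀ᵐ z ∂volIoi.prod volIoi, 0 < 1 + z.1 := by
    filter_upwards [ae_volIoi_prod_pos] with z hz
    linarith [hz.1]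
  have hg : Measurable (fun y : ℝ => (y : ℂ) ^ (p - 1) * ((1 + y : ℝ) : ℂ) ^ (-s)) := by fun_prop
  have hg2 : Measurable (fun z : ℝ × ℝ => (z.1 : ℂ) ^ (p - 1) *
    ((z.2 : ℂ) ^ (s - 1) * cexp (-((1 + z.1 : ℝ) * z.2)))) := by fun_prop
  have e1 : (fun y : ℝ => (y : ℂ) ^ (p - 1) * ((1 + y : ℝ) : ℂ) ^ (-s) *
      ((1 + y : ℝ) : ℂ) ^ (-s)) =ᵐ[volIoi]
      fun y : ℝ => (y : ℂ) ^ (p - 1) * ((1 + y : ℝ) : ℂ) ^ (-(p + q)) := by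
    filter_upwards [hpos] with y hy
    rw [mul_assoc, ← cpow_add _ _ (ofReal_ne_zero.2 hy.ne'), hpq]
    congr 2
    ring
  have hI1 := (integrable_congr e1).2 hA
  have hV1 := integral_congr_ae e1
  have hI2 := (integrable_prod_gamma_iff hg hc hpos hs).2 hI1
  have hV2 := integral_prod_gamma hg hc hpos hs hI1
  have e2 : (fun w : ℝ × ℝ => ((w.1 : ℂ) ^ (p - 1) * ((1 + w.1 : ℝ) : ℂ) ^ (-s)) *
        ((w.2 : ℂ) ^ (s - 1) * cexp (-((1 + w.1 : ℝ) * w.2)))) =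
      fun w : ℝ × ℝ => ((w.1 : ℂ) ^ (p - 1) *
        ((w.2 : ℂ) ^ (s - 1) * cexp (-((1 + w.1 : ℝ) * w.2)))) * ((1 + w.1 : ℝ) : ℂ) ^ (-s) := by
    funext w
    ring
  rw [e2] at hI2 hV2
  have hI3 := (integrable_prod_gamma_iff hg2 hc2 hpos2 hs).2 hI2
  have hV3 := integral_prod_gamma hg2 hc2 hpos2 hs hI2
  -- The construction yields the order `((y, t₁), t₂)`; permute it to `((t₁, t₂), y)`.
  have hmp : MeasurePreserving
      ((MeasurableEquiv.prodAssoc : (ℝ × ℝ) × ℝ ≃ᵐ ℝ × ℝ × ℝ).trans MeasurableEquiv.prodComm)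
      ((volIoi.prod volIoi).prod volIoi) ((volIoi.prod volIoi).prod volIoi) :=
    Measure.measurePreserving_swap.comp (measurePreserving_prodAssoc volIoi volIoi volIoi)
  have e3 : (fun w : (ℝ × ℝ) × ℝ => ((w.1.1 : ℂ) ^ (p - 1) *
        ((w.1.2 : ℂ) ^ (s - 1) * cexp (-((1 + w.1.1 : ℝ) * w.1.2)))) *
        ((w.2 : ℂ) ^ (s - 1) * cexp (-((1 + w.1.1 : ℝ) * w.2)))) =
      (fun x : (ℝ × ℝ) × ℝ =>
        ((x.1.1 : ℂ) ^ (s - 1) * (x.1.2 : ℂ) ^ (s - 1) * cexp (-(x.1.1 + x.1.2))) *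
          ((x.2 : ℂ) ^ (p - 1) * cexp (-((x.1.1 + x.1.2 : ℝ) * x.2)))) ∘
      ((MeasurableEquiv.prodAssoc : (ℝ × ℝ) × ℝ ≃ᵐ ℝ × ℝ × ℝ).trans
        MeasurableEquiv.prodComm) := by
    funext w
    have : cexp (-((1 + w.1.1 : ℝ) * w.1.2)) * cexp (-((1 + w.1.1 : ℝ) * w.2)) =
        cexp (-(w.1.2 + w.2)) * cexp (-((w.1.2 + w.2 : ℝ) * w.1.1)) := by
      rw [← Complex.exp_add, ← Complex.exp_add]; congr 1; push_cast; ring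
    change _ = ((w.1.2 : ℂ) ^ (s - 1) * (w.2 : ℂ) ^ (s - 1) * cexp (-(w.1.2 + w.2))) *
          ((w.1.1 : ℂ) ^ (p - 1) * cexp (-((w.1.2 + w.2 : ℝ) * w.1.1)))
    linear_combination ((w.1.1 : ℂ) ^ (p - 1) * (w.1.2 : ℂ) ^ (s - 1) * (w.2 : ℂ) ^ (s - 1)) * this
  rw [e3] at hI3 hV3
  refine ⟨(hmp.integrable_comp_emb (MeasurableEquiv.measurableEmbedding _)).1 hI3, ?_⟩
  have hV4 := hmp.integral_comp (MeasurableEquiv.measurableEmbedding _) (fun x : (ℝ × ℝ) × ℝ =>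
        ((x.1.1 : ℂ) ^ (s - 1) * (x.1.2 : ℂ) ^ (s - 1) * cexp (-(x.1.1 + x.1.2))) *
          ((x.2 : ℂ) ^ (p - 1) * cexp (-((x.1.1 + x.1.2 : ℝ) * x.2))))
  rw [← hV4]
  simp only [Function.comp_def] at hV3
  rw [hV3, hV2, hV1, ← hAv, hpq]
  ring

/-- The integrand of the triple integral representing the Mellin transform of `K_ν ^ 2`. -/
theorem integrable_bessel_kernel {s ν : ℂ} (hs : 0 < s.re) (hp : 0 < (s + ν).re)
    (hq : 0 < (s - ν).re) :
    Integrable (fun x : (ℝ × ℝ) × ℝ =>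
        ((x.1.1 : ℂ) ^ (-ν - 1) * (x.1.2 : ℂ) ^ (-ν - 1) * cexp (-(x.1.1 + x.1.2))) *
          ((x.2 : ℂ) ^ (s + ν - 1) * cexp (-((1 / x.1.1 + 1 / x.1.2 : ℝ) * x.2))))
        ((volIoi.prod volIoi).prod volIoi) ∧
      Gamma (2 * s) * ∫ x : (ℝ × ℝ) × ℝ,
        ((x.1.1 : ℂ) ^ (-ν - 1) * (x.1.2 : ℂ) ^ (-ν - 1) * cexp (-(x.1.1 + x.1.2))) *
          ((x.2 : ℂ) ^ (s + ν - 1) * cexp (-((1 / x.1.1 + 1 / x.1.2 : ℝ) * x.2)))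
        ∂(volIoi.prod volIoi).prod volIoi = Gamma s ^ 2 * (Gamma (s + ν) * Gamma (s - ν)) := by
  obtain ⟨hH, hHv⟩ := integrable_beta_kernel hs hp hq (by ring)
  have hg1 : Measurable (fun z : ℝ × ℝ =>
    (z.1 : ℂ) ^ (s - 1) * (z.2 : ℂ) ^ (s - 1) * cexp (-(z.1 + z.2))) := by fun_prop
  have hc1 : Measurable (fun z : ℝ × ℝ => z.1 + z.2) := by fun_prop
  have hg2 : Measurable (fun z : ℝ × ℝ =>
    (z.1 : ℂ) ^ (-ν - 1) * (z.2 : ℂ) ^ (-ν - 1) * cexp (-(z.1 + z.2))) := by fun_prop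
  have hc2 : Measurable (fun z : ℝ × ℝ => 1 / z.1 + 1 / z.2) := by fun_prop
  have hpos1 : ∀ᵐ z ∂volIoi.prod volIoi, 0 < z.1 + z.2 := by
    filter_upwards [ae_volIoi_prod_pos] with z hz
    exact add_pos hz.1 hz.2
  have hpos2 : ∀ᵐ z ∂volIoi.prod volIoi, 0 < 1 / z.1 + 1 / z.2 := by
    filter_upwards [ae_volIoi_prod_pos] with z hz
    exact add_pos (one_div_pos.2 hz.1) (one_div_pos.2 hz.2)
  have e : (fun z : ℝ × ℝ => (z.1 : ℂ) ^ (-ν - 1) * (z.2 : ℂ) ^ (-ν - 1) * cexp (-(z.1 + z.2)) *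
        ((1 / z.1 + 1 / z.2 : ℝ) : ℂ) ^ (-(s + ν))) =ᵐ[volIoi.prod volIoi]
      fun z : ℝ × ℝ => (z.1 : ℂ) ^ (s - 1) * (z.2 : ℂ) ^ (s - 1) * cexp (-(z.1 + z.2)) *
        ((z.1 + z.2 : ℝ) : ℂ) ^ (-(s + ν)) := by
    filter_upwards [ae_volIoi_prod_pos] with z hz
    obtain ⟨h1, h2⟩ := hz
    have h1' : (z.1 : ℂ) ≠ 0 := ofReal_ne_zero.2 h1.ne'
    have h2' : (z.2 : ℂ) ≠ 0 := ofReal_ne_zero.2 h2.ne'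
    have hr : ((1 / z.1 + 1 / z.2 : ℝ) : ℂ) =
        ((1 / z.1 : ℝ) : ℂ) * (((1 / z.2 : ℝ) : ℂ) * ((z.1 + z.2 : ℝ) : ℂ)) := by
      push_cast; field_simp; ring
    have hr' : ((1 / z.1 + 1 / z.2 : ℝ) : ℂ) ^ (-(s + ν)) =
        (z.1 : ℂ) ^ (s + ν) * ((z.2 : ℂ) ^ (s + ν) * ((z.1 + z.2 : ℝ) : ℂ) ^ (-(s + ν))) := by
      rw [hr, ← ofReal_mul, ofReal_mul_cpow (one_div_pos.2 h1)
        (mul_pos (one_div_pos.2 h2) (add_pos h1 h2)), ofReal_mul,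
        ofReal_mul_cpow (one_div_pos.2 h2) (add_pos h1 h2)]
      simp only [ofReal_div, ofReal_one]
      rw [one_div_ofReal_cpow h1, one_div_ofReal_cpow h2, neg_neg]
    have hs1 : (z.1 : ℂ) ^ (s - 1) = (z.1 : ℂ) ^ (-ν - 1) * (z.1 : ℂ) ^ (s + ν) := by
      rw [← cpow_add _ _ h1']; congr 1; ring
    have hs2 : (z.2 : ℂ) ^ (s - 1) = (z.2 : ℂ) ^ (-ν - 1) * (z.2 : ℂ) ^ (s + ν) := by
      rw [← cpow_add _ _ h2']; congr 1; ring
    rw [hr', hs1, hs2]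
    ring
  have hG := (integrable_prod_gamma_iff hg1 hc1 hpos1 hp).1 hH
  have hGv := integral_prod_gamma hg1 hc1 hpos1 hp hG
  have hG' := (integrable_congr e).2 hG
  refine ⟨(integrable_prod_gamma_iff hg2 hc2 hpos2 hp).2 hG', ?_⟩
  rw [integral_prod_gamma hg2 hc2 hpos2 hp hG', integral_congr_ae e, ← hGv, hHv]

/-! ### Mellin transform of the squared Bessel function -/

/-- `∫ exp (-t - w / t) dt / t ^ (ν + 1)` over the positive half-line. -/
noncomputable def besselIntegral (ν : ℂ) (w : ℝ) : ℂ :=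
  ∫ t : ℝ, (t : ℂ) ^ (-ν - 1) * cexp (-t - w / t) ∂volIoi

theorem besselK_two_mul (ν : ℂ) {x : ℝ} (hx : 0 < x) :
    besselK ν (2 * x) = (x : ℂ) ^ ν / 2 * besselIntegral ν (x ^ 2) := by
  rw [besselK, besselIntegral]
  congr 1
  · have h := ofReal_mul_cpow two_pos hx ν
    have h2 : (2 : ℂ) ^ ν ≠ 0 := by simp [cpow_eq_zero_iff]
    rw [ofReal_mul, h, cpow_add _ _ two_ne_zero, cpow_one]
    simp only [ofReal_ofNat]
    field_simp
  · refine setIntegral_congr_fun measurableSet_Ioi fun t ht => ?_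
    have h : -t - (2 * x) ^ 2 / (4 * t) = -t - x ^ 2 / t := by
      have : t ≠ 0 := ht.ne'
      field_simp
      ring
    simp only [h]
    rw [show -ν - 1 = -(ν + 1) by ring, cpow_neg]
    push_cast
    rw [div_eq_inv_mul]

theorem mellin_besselIntegral_sq {s ν : ℂ} (hs : 0 < s.re) (hp : 0 < (s + ν).re)
    (hq : 0 < (s - ν).re) :
    Integrable (fun w : ℝ => (w : ℂ) ^ (s + ν - 1) * besselIntegral ν w ^ 2) volIoi ∧
      Gamma (2 * s) * ∫ w : ℝ, (w : ℂ) ^ (s + ν - 1) * besselIntegral ν w ^ 2 ∂volIoi =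
        Gamma s ^ 2 * (Gamma (s + ν) * Gamma (s - ν)) := by
  obtain ⟨hF, hFv⟩ := integrable_bessel_kernel hs hp hq
  have e : ∀ w : ℝ, ∫ z : ℝ × ℝ,
        ((z.1 : ℂ) ^ (-ν - 1) * (z.2 : ℂ) ^ (-ν - 1) * cexp (-(z.1 + z.2))) *
          ((w : ℂ) ^ (s + ν - 1) * cexp (-((1 / z.1 + 1 / z.2 : ℝ) * w)))
        ∂volIoi.prod volIoi = (w : ℂ) ^ (s + ν - 1) * besselIntegral ν w ^ 2 := by
    intro w
    rw [besselIntegral, sq, ← integral_prod_mul, ← integral_const_mul]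
    congr 1
    funext z
    have : cexp (-(z.1 + z.2)) * cexp (-((1 / z.1 + 1 / z.2 : ℝ) * w)) =
        cexp (-z.1 - w / z.1) * cexp (-z.2 - w / z.2) := by
      rw [← Complex.exp_add, ← Complex.exp_add]; congr 1; push_cast; ring
    linear_combination
      ((z.1 : ℂ) ^ (-ν - 1) * (z.2 : ℂ) ^ (-ν - 1) * (w : ℂ) ^ (s + ν - 1)) * this
  refine ⟨?_, ?_⟩
  · simpa only [e] using hF.integral_prod_right
  · rw [integral_prod_symm _ hF] at hFv
    simpa only [e] using hFv

theorem mellin_besselK_two_mul_sq {s ν : ℂ} (hs : 0 < s.re) (hp : 0 < (s + ν).re)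
    (hq : 0 < (s - ν).re) :
    IntegrableOn (fun x : ℝ => (x : ℂ) ^ (2 * s - 1) * besselK ν (2 * x) ^ 2) (Ioi 0) ∧
      ∫ x in Ioi (0 : ℝ), (x : ℂ) ^ (2 * s - 1) * besselK ν (2 * x) ^ 2 =
        Gamma s ^ 2 * (Gamma (s + ν) * Gamma (s - ν)) / (8 * Gamma (2 * s)) := by
  obtain ⟨hI, hV⟩ := mellin_besselIntegral_sq hs hp hq
  have hG : Gamma (2 * s) ≠ 0 := Gamma_ne_zero_of_re_pos (by simpa using hs)
  -- The `1/8` is `1/4` from squaring the prefactor, times `1/2` from the Jacobian `2x` of `w = x ^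
  -- 2`.
  have e : EqOn (fun x : ℝ => (x : ℂ) ^ (2 * s - 1) * besselK ν (2 * x) ^ 2)
      (fun x : ℝ => (1 / 8 : ℂ) * ((|(2 : ℝ)| * x ^ ((2 : ℝ) - 1)) •
        (((x ^ (2 : ℝ) : ℝ) : ℂ) ^ (s + ν - 1) * besselIntegral ν (x ^ (2 : ℝ)) ^ 2)))
      (Ioi 0) := by
    intro x hx
    have hx' : (x : ℂ) ≠ 0 := ofReal_ne_zero.2 hx.ne'
    have h1 : (x : ℂ) ^ (2 * s - 1) * (x : ℂ) ^ ν * (x : ℂ) ^ ν =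
        x * ((x : ℂ) ^ (s + ν - 1) * (x : ℂ) ^ (s + ν - 1)) := by
      rw [← cpow_add _ _ hx', ← cpow_add _ _ hx', ← cpow_add _ _ hx']
      nth_rw 2 [← cpow_one (x : ℂ)]
      rw [← cpow_add _ _ hx']
      congr 1
      ring
    have h2 : ((x ^ 2 : ℝ) : ℂ) ^ (s + ν - 1) =
        (x : ℂ) ^ (s + ν - 1) * (x : ℂ) ^ (s + ν - 1) := by
      rw [← ofReal_mul_cpow hx hx, sq, ofReal_mul]
    have h3 : (2 : ℝ) - 1 = 1 := by norm_num
    simp only [besselK_two_mul ν hx, h3, Real.rpow_one, Real.rpow_two, h2, abs_two, real_smul,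
      ofReal_mul, ofReal_ofNat]
    linear_combination (besselIntegral ν (x ^ 2) ^ 2 / 4) * h1
  refine ⟨?_, ?_⟩
  · rw [integrableOn_congr_fun e measurableSet_Ioi]
    exact ((integrableOn_Ioi_comp_rpow_iff _ two_ne_zero).2 hI).const_mul _
  · rw [setIntegral_congr_fun measurableSet_Ioi e, integral_const_mul,
      integral_comp_rpow_Ioi (fun w : ℝ => (w : ℂ) ^ (s + ν - 1) * besselIntegral ν w ^ 2)
        two_ne_zero, ← hV, eq_div_iff (mul_ne_zero (by norm_num) hG)]
    ring

theorem mellin_besselK_sq {a : ℝ} (ha : 0 < a) {s ν : ℂ} (hs : 0 < s.re) (hp : 0 < (s + ν).re)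
    (hq : 0 < (s - ν).re) :
    IntegrableOn (fun x : ℝ => (x : ℂ) ^ (2 * s - 1) * besselK ν (a * x) ^ 2) (Ioi 0) ∧
      ∫ x in Ioi (0 : ℝ), (x : ℂ) ^ (2 * s - 1) * besselK ν (a * x) ^ 2 =
        (2 : ℂ) ^ (2 * s - 3) / (a : ℂ) ^ (2 * s) *
          (Gamma s ^ 2 * (Gamma (s + ν) * Gamma (s - ν)) / Gamma (2 * s)) := by
  obtain ⟨hI, hV⟩ := mellin_besselK_two_mul_sq hs hp hq
  have hb : 0 < a / 2 := half_pos ha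
  have hb' : ((a / 2 : ℝ) : ℂ) ≠ 0 := ofReal_ne_zero.2 hb.ne'
  set f : ℝ → ℂ := fun x => (x : ℂ) ^ (2 * s - 1) * besselK ν (2 * x) ^ 2 with hf
  have e : EqOn (fun x : ℝ => (x : ℂ) ^ (2 * s - 1) * besselK ν (a * x) ^ 2)
      (fun x : ℝ => ((a / 2 : ℝ) : ℂ) ^ (-(2 * s - 1)) * f (a / 2 * x)) (Ioi 0) := by
    intro x hx
    have h : 2 * (a / 2 * x) = a * x := by ring
    simp only [hf, h]
    rw [ofReal_mul, ofReal_mul_cpow hb hx, ← mul_assoc, ← mul_assoc, ← cpow_add _ _ hb',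
      neg_add_cancel, cpow_zero, one_mul]
  refine ⟨?_, ?_⟩
  · rw [integrableOn_congr_fun e measurableSet_Ioi]
    refine Integrable.const_mul ?_ _
    have := integrableOn_Ioi_comp_mul_left_iff f 0 hb
    rw [mul_zero] at this
    exact this.2 hI
  · rw [setIntegral_congr_fun measurableSet_Ioi e, integral_const_mul,
      integral_comp_mul_left_Ioi f 0 hb, mul_zero, hV, real_smul, ofReal_inv, ← mul_assoc]
    nth_rw 2 [← cpow_one ((a / 2 : ℝ) : ℂ)]
    rw [← cpow_neg, ← cpow_add _ _ hb', show -(2 * s - 1) + -1 = -(2 * s) by ring]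
    have h1 : (a : ℂ) ^ (2 * s) = (2 : ℂ) ^ (2 * s) * ((a / 2 : ℝ) : ℂ) ^ (2 * s) := by
      rw [← ofReal_ofNat, ← ofReal_mul_cpow two_pos hb, ← ofReal_mul]
      congr 2
      ring
    have h2 : (2 : ℂ) ^ (2 * s - 3) = (2 : ℂ) ^ (2 * s) / 8 := by
      rw [cpow_sub _ _ two_ne_zero]
      congr 1
      rw [cpow_ofNat]
      norm_num
    have h3 : (2 : ℂ) ^ (2 * s) ≠ 0 := by simp [cpow_eq_zero_iff]
    have h4 : ((a / 2 : ℝ) : ℂ) ^ (2 * s) ≠ 0 := by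
      rw [Ne, cpow_eq_zero_iff]; tauto
    have hG : Gamma (2 * s) ≠ 0 := Gamma_ne_zero_of_re_pos (by simpa using hs)
    rw [h1, h2, cpow_neg]
    field_simp

/-! ### Gamma function identities -/

/-- Reflection, valid also at the poles of `Γ(1-z)`: there the sine vanishes and Lean's `1 / Gamma`
is `0`. -/
theorem one_div_Gamma_one_sub {z : ℂ} (hz : 0 < z.re) :
    1 / Gamma (1 - z) = Gamma z * sin (Real.pi * z) / Real.pi := by
  have h := Gamma_mul_Gamma_one_sub z
  have h0 : Gamma z ≠ 0 := Gamma_ne_zero_of_re_pos hz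
  have hpi : (Real.pi : ℂ) ≠ 0 := ofReal_ne_zero.2 Real.pi_ne_zero
  rw [eq_div_of_mul_eq h0 ((mul_comm _ _).trans h)]
  field_simp

/-- By reflection the bracket is `Γ(s+ν)Γ(s-ν) (sin π(s+ν) - sin π(s-ν)) / sin πν = 2 cos(πs)
Γ(s+ν)Γ(s-ν)`, and the prefactor is `Γ(s)^2 / (2 cos(πs) Γ(2s))`. -/
theorem gamma_side {ν s : ℂ} (hs : 0 < s.re) (hp : 0 < (s + ν).re) (hq : 0 < (s - ν).re)
    (hν : ∀ n : ℤ, ν ≠ (n : ℂ)) (hρ : ∀ n : ℕ, 2 * s ≠ (n : ℂ)) :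
    Complex.Gamma s * Complex.Gamma (1 - 2 * s) / Complex.Gamma (1 - s) *
          (Complex.Gamma ν * Complex.Gamma (1 - ν) * Complex.Gamma (s - ν) /
              Complex.Gamma (1 - s - ν) +
            Complex.Gamma (-ν) * Complex.Gamma (1 + ν) * Complex.Gamma (s + ν) /
              Complex.Gamma (1 - s + ν)) =
      Complex.Gamma s ^ 2 * (Complex.Gamma (s + ν) * Complex.Gamma (s - ν)) /
        Complex.Gamma (2 * s) := by
  have hpi : (Real.pi : ℂ) ≠ 0 := ofReal_ne_zero.2 Real.pi_ne_zero
  have hG : Gamma (2 * s) ≠ 0 := Gamma_ne_zero_of_re_pos (by simpa using hs)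
  have hsin2 : sin (Real.pi * (2 * s)) ≠ 0 := by
    rw [Ne, sin_eq_zero_iff]
    rintro ⟨k, hk⟩
    have hk' : 2 * s = (k : ℂ) := mul_left_cancel₀ hpi (hk.trans (mul_comm _ _))
    -- Since `Re s > 0`, an integer value of `2s` would be a natural number, which `hρ` excludes.
    have hk0 : (0 : ℝ) < k := by
      have := congrArg re hk'
      simp only [mul_re, re_ofNat, im_ofNat, zero_mul, sub_zero, intCast_re] at this
      linarith
    lift k to ℕ using by exact_mod_cast hk0.le
    exact hρ k (by simpa using hk')
  have hsinν : sin (Real.pi * ν) ≠ 0 := by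
    rw [Ne, sin_eq_zero_iff]
    rintro ⟨k, hk⟩
    exact hν k (mul_left_cancel₀ hpi (hk.trans (mul_comm _ _)))
  have hA : Gamma (1 - 2 * s) = Real.pi / sin (Real.pi * (2 * s)) / Gamma (2 * s) :=
    eq_div_of_mul_eq hG ((mul_comm _ _).trans (Gamma_mul_Gamma_one_sub _))
  have hB := one_div_Gamma_one_sub hs
  have hC := one_div_Gamma_one_sub hp
  have hD := one_div_Gamma_one_sub hq
  have hE := Gamma_mul_Gamma_one_sub ν
  have hF := Gamma_mul_Gamma_one_sub (-ν)
  rw [sub_neg_eq_add, mul_neg, sin_neg] at hF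
  rw [show 1 - s - ν = 1 - (s + ν) by ring, show 1 - s + ν = 1 - (s - ν) by ring,
    div_eq_mul_one_div _ (Gamma (1 - s)), div_eq_mul_one_div _ (Gamma (1 - (s + ν))),
    div_eq_mul_one_div _ (Gamma (1 - (s - ν))), hA, hB, hC, hD, hE, hF]
  have h2 : sin (Real.pi * (2 * s)) = 2 * sin (Real.pi * s) * cos (Real.pi * s) := by
    rw [← sin_two_mul]; congr 1; ring
  rw [h2] at hsin2 ⊢
  obtain ⟨h3, h4⟩ := mul_ne_zero_iff.1 hsin2
  have h5 : sin (Real.pi * s) ≠ 0 := (mul_ne_zero_iff.1 h3).2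
  rw [mul_add (Real.pi : ℂ), mul_sub (Real.pi : ℂ), sin_add, sin_sub]
  generalize Gamma (2 * s) = G at hG ⊢
  field_simp
  ring

end

theorem mainTheorem6 (a : ℝ) (ν ρ : ℂ) (ha : 0 < a)
    (hconv : 2 * |ν.re| < ρ.re)
    (hν : ∀ n : ℤ, ν ≠ (n : ℂ)) (hρ : ∀ n : ℕ, ρ ≠ (n : ℂ)) :
    MeasureTheory.IntegrableOn
        (fun x : ℝ => (x : ℂ) ^ (ρ - 1) * besselK ν (a * x) ^ 2) (Set.Ioi 0) ∧
      ∫ x in Set.Ioi (0 : ℝ), (x : ℂ) ^ (ρ - 1) * besselK ν (a * x) ^ 2 =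
        (2 : ℂ) ^ (ρ - 3) / (a : ℂ) ^ ρ *
          (Complex.Gamma (ρ / 2) * Complex.Gamma (1 - ρ) / Complex.Gamma (1 - ρ / 2)) *
          (Complex.Gamma ν * Complex.Gamma (1 - ν) * Complex.Gamma (ρ / 2 - ν) /
              Complex.Gamma (1 - ρ / 2 - ν) +
            Complex.Gamma (-ν) * Complex.Gamma (1 + ν) * Complex.Gamma (ρ / 2 + ν) /
              Complex.Gamma (1 - ρ / 2 + ν)) := by
  obtain ⟨s, rfl⟩ : ∃ s, ρ = 2 * s := ⟨ρ / 2, by ring⟩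
  have hre : (2 * s).re = 2 * s.re := by simp
  rw [hre] at hconv
  have hlt : |ν.re| < s.re := by linarith
  obtain ⟨h1, h2⟩ := abs_lt.1 hlt
  have hs : 0 < s.re := (abs_nonneg _).trans_lt hlt
  have hp : 0 < (s + ν).re := by rw [Complex.add_re]; linarith
  have hq : 0 < (s - ν).re := by rw [Complex.sub_re]; linarith
  obtain ⟨hI, hV⟩ := mellin_besselK_sq ha hs hp hq
  refine ⟨hI, ?_⟩
  rw [hV, mul_div_cancel_left₀ s two_ne_zero, mul_assoc, gamma_side hs hp hq hν hρ]
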